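/- Let $K$ be a field of characteristic zero, let $n\ge 1$, and let $S=K[X_0,\dots,X_n]$ be the standard graded polynomial ring with homogeneous maximal ideal $\mathfrak{M}=\langle X_0,\dots,X_n\rangle$. Let $P_1,\dots,P_s$ be distinct $K$-rational points of $\mathbb{P}^n$, let $I_{P_j}\subseteq S$ be the homogeneous vanishing ideal of $P_j$, i.e. the ideal generated by all homogeneous polynomials vanishing at $P_j$, and write $\mathbb{X}=P_1+\cdots+P_s$, $I_{\mathbb{X}}=I_{P_1}\cap\cdots\cap I_{P_s}$, and $I_{m\mathbb{X}}=I_{P_1}^m\cap\cdots\cap I_{P_s}^m$ for $m\ge 1$. For a homogeneous ideal $I$ of $S$, let $I_i$ denote its homogeneous component of degree $i$, and let $\partial I=\langle \frac{\partial F}{\partial X_j} \mid F\in I,\ 0\le j\le n\rangle$. Then for every $\nu\ge 1$ there exists $i_0\in\mathbb{N}$ such that for all $i\ge i_0$ we have $$(\partial I_{\mathbb{X}})_i=\mathfrak{M}_i$$ and $$(\partial (I_{\mathbb{X}}^{\nu+1}))_i=(\partial I_{(\nu+1)\mathbb{X}})_i=(I_{\nu\mathbb{X}})_i=(I_{\mathbb{X}}^{\nu})_i.$$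 -/

import Mathlib

open scoped LinearAlgebra.Projectivization

namespace FatPoints

variable {K : Type*} [Field K] {n : ℕ}

/-- The homogeneous vanishing ideal `I_P ⊆ S = K[X_0, …, X_n]` of a `K`-rational point `P` of
projective `n`-space: the ideal generated by the homogeneous polynomials that vanish at `P`.
For a homogeneous polynomial the vanishing does not depend on the chosen representative of `P`. -/
noncomputable def pointIdeal (P : ℙ K (Fin (n + 1) → K)) :
    Ideal (MvPolynomial (Fin (n + 1)) K) :=
  Ideal.span {F | (∃ d : ℕ, F.IsHomogeneous d) ∧ MvPolynomial.eval P.rep F = 0}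

/-- The ideal `I_{P_1}^{m_1} ∩ ⋯ ∩ I_{P_s}^{m_s}` of the fat point scheme
`m_1 P_1 + ⋯ + m_s P_s`. -/
noncomputable def fatPointIdeal {s : ℕ} (P : Fin s → ℙ K (Fin (n + 1) → K)) (m : Fin s → ℕ) :
    Ideal (MvPolynomial (Fin (n + 1)) K) :=
  ⨅ j, pointIdeal (P j) ^ m j

/-- The ideal of the equimultiple fat point scheme `m𝕏 = m P_1 + ⋯ + m P_s`. -/
noncomputable def equiIdeal {s : ℕ} (P : Fin s → ℙ K (Fin (n + 1) → K)) (m : ℕ) :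
    Ideal (MvPolynomial (Fin (n + 1)) K) :=
  fatPointIdeal P (fun _ => m)

/-- The vanishing ideal `I_𝕏 = I_{P_1} ∩ ⋯ ∩ I_{P_s}` of `𝕏 = P_1 + ⋯ + P_s`. -/
noncomputable def vanIdeal {s : ℕ} (P : Fin s → ℙ K (Fin (n + 1) → K)) :
    Ideal (MvPolynomial (Fin (n + 1)) K) :=
  ⨅ j, pointIdeal (P j)

/-- The ideal `∂I` generated by all partial derivatives of all elements of `I`. -/
noncomputable def partialIdeal (I : Ideal (MvPolynomial (Fin (n + 1)) K)) :
    Ideal (MvPolynomial (Fin (n + 1)) K) :=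
  Ideal.span {G | ∃ F ∈ I, ∃ j : Fin (n + 1), G = MvPolynomial.pderiv j F}

/-- The homogeneous maximal ideal `𝔐 = ⟨X_0, …, X_n⟩`. -/
noncomputable def maxIdeal (K : Type*) [Field K] (n : ℕ) :
    Ideal (MvPolynomial (Fin (n + 1)) K) :=
  Ideal.span (Set.range MvPolynomial.X)

/-- The homogeneous component `I_i = I ∩ S_i` of degree `i` of an ideal `I` of `S`. -/
noncomputable def degPart (I : Ideal (MvPolynomial (Fin (n + 1)) K)) (i : ℕ) :
    Submodule K (MvPolynomial (Fin (n + 1)) K) :=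
  I.restrictScalars K ⊓ MvPolynomial.homogeneousSubmodule (Fin (n + 1)) K i

end FatPoints

/-! The ideals satisfy `∂(I_𝕏^(ν+1)) ≤ ∂I_((ν+1)𝕏) ≤ I_(ν𝕏)` and `I_𝕏^ν ≤ I_(ν𝕏)`, so it suffices
that some `𝔐^r * I_(ν𝕏)` lies in both `∂(I_𝕏^(ν+1))` and `I_𝕏^ν`; Artin-Rees
(`exists_degPart_eq_of_pow_mul_le`) then gives equality in large degrees. At one point, an
Euler-type derivation shows `I_P^ν ≤ ∂(I_P^(ν+1))`; this is where characteristic zero enters. To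
pass to all points, let `H_j` be the product of the other point ideals. Then `H_j * I_(P_j) ≤ I_𝕏`,
and since two distinct points have no common zero outside the origin, a power of `𝔐` lies in `∑
H_j^N`. The claim on `∂I_𝕏` is the case `ν = 0`, where `I_(0𝕏) = S`. -/

namespace FatPoints

open MvPolynomial

/-! ### Derivations and powers of ideals -/

section Derivations

variable {R A : Type*} [CommRing R] [CommRing A] [Algebra R A]

/-- A derivation lowers the order of vanishing along an ideal by at most one. -/
theorem derivation_mem_pow (D : Derivation R A A) (I : Ideal A) (m : ℕ) {a : A}
    (ha : a ∈ I ^ (m + 1)) : D a ∈ I ^ m := by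
  induction m generalizing a with
  | zero => simp
  | succ m ih =>
    rw [pow_succ] at ha
    induction ha using Submodule.mul_induction_on' with
    | mem_mul_mem x hx y hy =>
      rw [D.leibniz, smul_eq_mul, smul_eq_mul]
      refine add_mem (Ideal.mul_mem_right _ _ hx) ?_
      rw [pow_succ, mul_comm y]
      exact Ideal.mul_mem_mul (ih hx) hy
    | add x _ y _ hx hy =>
      rw [map_add]
      exact add_mem hx hy

/-- If a derivation `E` fixes generators of `I = ⟨ℓ⟩` and maps everything into `I`, then it acts
on `I ^ m / I ^ (m + 1)` as multiplication by `m`. -/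
theorem derivation_sub_natCast_mul_mem_pow {ι : Type*} (E : Derivation R A A) (l : ι → A)
    (hl : ∀ k, E (l k) = l k) (hE : ∀ a, E a ∈ Ideal.span (Set.range l)) (m : ℕ) {a : A}
    (ha : a ∈ Ideal.span (Set.range l) ^ m) :
    E a - m * a ∈ Ideal.span (Set.range l) ^ (m + 1) := by
  set I := Ideal.span (Set.range l) with hI
  have base : ∀ a ∈ I, E a - a ∈ I ^ 2 := by
    intro a ha
    induction ha using Submodule.span_induction with
    | mem x hx =>
      obtain ⟨k, rfl⟩ := hx
      simp [hl]
    | zero => simp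
    | add x y _ _ hx hy =>
      have : E (x + y) - (x + y) = (E x - x) + (E y - y) := by rw [map_add]; ring
      rw [this]
      exact add_mem hx hy
    | smul r x hx ih =>
      have : E (r • x) - r • x = r * (E x - x) + x * E r := by
        simp only [smul_eq_mul, E.leibniz]; ring
      rw [this]
      refine add_mem (Ideal.mul_mem_left _ _ ih) ?_
      rw [pow_two]
      exact Ideal.mul_mem_mul hx (hE r)
  induction m generalizing a with
  | zero => simpa using hE a
  | succ m ih =>
    rw [pow_succ] at ha
    induction ha using Submodule.mul_induction_on' with
    | mem_mul_mem x hx y hy =>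
      have : E (x * y) - ((m + 1 : ℕ) : A) * (x * y)
          = (E x - m * x) * y + x * (E y - y) := by
        simp only [smul_eq_mul, E.leibniz]; push_cast; ring
      rw [this]
      refine add_mem ?_ ?_
      · rw [pow_succ]
        exact Ideal.mul_mem_mul (ih hx) hy
      · rw [show m + 1 + 1 = m + 2 from rfl, pow_add]
        exact Ideal.mul_mem_mul hx (base y hy)
    | add x _ y _ hx hy =>
      have : E (x + y) - ((m + 1 : ℕ) : A) * (x + y)
          = (E x - ((m + 1 : ℕ) : A) * x) + (E y - ((m + 1 : ℕ) : A) * y) := by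
        rw [map_add]; ring
      rw [this]
      exact add_mem hx hy

end Derivations

/-! ### Ideals that are pairwise comaximal up to radical -/

section PairwiseCoprime

variable {A ι : Type*} [CommRing A] [Fintype ι] [DecidableEq ι]

/-- If `M ≤ I j + I k` for all `j ≠ k`, then some power of the finitely generated ideal `M` lies in
the sum of the powers of the products `∏_{k ≠ j} I k`. -/
theorem exists_pow_le_iSup_prod_erase_pow [Nonempty ι] {M : Ideal A} (hM : M.FG) (I : ι → Ideal A)
    (h : ∀ j k, j ≠ k → M ≤ I j ⊔ I k) (N : ℕ) :
    ∃ r : ℕ, M ^ r ≤ ⨆ j, (∏ k ∈ Finset.univ.erase j, I k) ^ N := by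
  refine Ideal.exists_pow_le_of_le_radical_of_fg ?_ hM
  rw [Ideal.radical_eq_sInf]
  refine le_sInf fun p hp => ?_
  obtain ⟨hp, hprime⟩ := hp
  -- Using this twice puts two distinct `I j`, `I k` inside `p`, hence `M` too.
  have key : ∀ j, ∃ k, k ≠ j ∧ I k ≤ p := by
    intro j
    have h1 : (∏ k ∈ Finset.univ.erase j, I k) ≤ p :=
      hprime.le_of_pow_le ((le_iSup (fun j => (∏ k ∈ Finset.univ.erase j, I k) ^ N) j).trans hp)
    obtain ⟨k, hk, hkp⟩ := hprime.prod_le.1 h1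
    exact ⟨k, Finset.ne_of_mem_erase hk, hkp⟩
  obtain ⟨j, -, hj⟩ := key (Classical.arbitrary ι)
  obtain ⟨k, hkj, hk⟩ := key j
  exact (h k j hkj).trans (sup_le hk hj)

theorem prod_erase_mul_le_iInf (I : ι → Ideal A) (j : ι) :
    (∏ k ∈ Finset.univ.erase j, I k) * I j ≤ ⨅ k, I k := by
  rw [Finset.prod_erase_mul _ _ (Finset.mem_univ j)]
  refine le_iInf fun k => ?_
  exact Ideal.prod_le_inf.trans (Finset.inf_le (Finset.mem_univ k))

end PairwiseCoprime

/-! ### The ideal of partial derivatives and large degrees -/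

section PolynomialRing

variable {K : Type*} [Field K] {n : ℕ}

theorem pderiv_mem_partialIdeal {I : Ideal (MvPolynomial (Fin (n + 1)) K)}
    {F : MvPolynomial (Fin (n + 1)) K} (hF : F ∈ I) (j : Fin (n + 1)) :
    pderiv j F ∈ partialIdeal I :=
  Ideal.subset_span ⟨F, hF, j, rfl⟩

theorem partialIdeal_mono {I J : Ideal (MvPolynomial (Fin (n + 1)) K)} (h : I ≤ J) :
    partialIdeal I ≤ partialIdeal J := by
  refine Ideal.span_mono ?_
  rintro _ ⟨F, hF, j, rfl⟩
  exact ⟨F, h hF, j, rfl⟩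

/-- The product rule for `X 0 * F` recovers `F`, in any characteristic. -/
theorem le_partialIdeal (I : Ideal (MvPolynomial (Fin (n + 1)) K)) : I ≤ partialIdeal I := by
  intro F hF
  have h : F = pderiv 0 (X 0 * F) - X 0 * pderiv 0 F := by
    rw [Derivation.leibniz, pderiv_X_self]
    simp
  rw [h]
  exact sub_mem (pderiv_mem_partialIdeal (I.mul_mem_left _ hF) 0)
    (Ideal.mul_mem_left _ _ (pderiv_mem_partialIdeal hF 0))

theorem partialIdeal_pow_le (I : Ideal (MvPolynomial (Fin (n + 1)) K)) (m : ℕ) :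
    partialIdeal (I ^ (m + 1)) ≤ I ^ m := by
  refine Ideal.span_le.2 ?_
  rintro _ ⟨F, hF, j, rfl⟩
  exact derivation_mem_pow _ I m hF

/-- Clearing denominators: multiplication by `H ^ (m + 2)` moves `∂(J ^ (m + 1))` into
`∂(I ^ (m + 1))` as soon as `H J ⊆ I`. -/
theorem pow_mul_partialIdeal_pow_le {H J I : Ideal (MvPolynomial (Fin (n + 1)) K)}
    (h : H * J ≤ I) (m : ℕ) :
    H ^ (m + 2) * partialIdeal (J ^ (m + 1)) ≤ partialIdeal (I ^ (m + 1)) := by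
  have hmul : H ^ (m + 1) * J ^ (m + 1) ≤ I ^ (m + 1) := by
    rw [← mul_pow]
    exact Ideal.pow_right_mono h _
  rw [partialIdeal, Ideal.mul_le]
  intro a ha b hb
  induction hb using Submodule.span_induction with
  | mem x hx =>
    obtain ⟨G, hG, j, rfl⟩ := hx
    -- The exponent `m + 2` leaves `pderiv j a` in `H ^ (m + 1)`.
    have e : a * pderiv j G = pderiv j (a * G) - pderiv j a * G := by
      rw [Derivation.leibniz, smul_eq_mul, smul_eq_mul]; ring
    rw [e]
    refine sub_mem (pderiv_mem_partialIdeal (hmul (Ideal.mul_mem_mul ?_ hG)) j)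
      (le_partialIdeal _ (hmul (Ideal.mul_mem_mul (derivation_mem_pow _ H (m + 1) ha) hG)))
    exact Ideal.pow_le_pow_right (by omega) ha
  | zero => simp
  | add x y _ _ hx hy => rw [mul_add]; exact add_mem hx hy
  | smul r x _ hx =>
    rw [smul_eq_mul, mul_left_comm]
    exact Ideal.mul_mem_left _ _ hx

theorem mem_maxIdeal_pow_of_isHomogeneous {F : MvPolynomial (Fin (n + 1)) K} {i : ℕ}
    (hF : F.IsHomogeneous i) : F ∈ maxIdeal K n ^ i := by
  refine (mem_pow_idealOfVars_iff' i F).2 fun x hx => ?_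
  exact hF.coeff_eq_zero hx.ne

/-- By the Artin-Rees lemma, ideals `J ≤ I` with `𝔐 ^ r * I ≤ J` agree in all large degrees. -/
theorem exists_degPart_eq_of_pow_mul_le {I J : Ideal (MvPolynomial (Fin (n + 1)) K)}
    (hJI : J ≤ I) (h : ∃ r : ℕ, maxIdeal K n ^ r * I ≤ J) :
    ∃ i₀ : ℕ, ∀ i, i₀ ≤ i → degPart J i = degPart I i := by
  obtain ⟨r, hr⟩ := h
  obtain ⟨k, hk⟩ := Ideal.exists_pow_inf_eq_pow_smul (maxIdeal K n) I
  refine ⟨k + r, fun i hi => le_antisymm (fun F hF => ⟨hJI hF.1, hF.2⟩) ?_⟩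
  rintro F ⟨hF, hFi⟩
  refine ⟨?_, hFi⟩
  have h1 : F ∈ (maxIdeal K n ^ i • ⊤ ⊓ I : Ideal _) := by
    refine ⟨?_, hF⟩
    simpa using mem_maxIdeal_pow_of_isHomogeneous hFi
  rw [hk i (by omega)] at h1
  refine hr ?_
  rw [smul_eq_mul] at h1
  exact Ideal.mul_mono (Ideal.pow_le_pow_right (by omega)) inf_le_right h1

theorem degPart_maxIdeal {i : ℕ} (hi : 1 ≤ i) :
    degPart (maxIdeal K n) i = degPart ⊤ i := by
  refine le_antisymm (fun F hF => ⟨trivial, hF.2⟩) fun F hF => ⟨?_, hF.2⟩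
  exact Ideal.pow_le_self (by omega) (mem_maxIdeal_pow_of_isHomogeneous hF.2)

end PolynomialRing

/-! ### The ideal of a single point -/

section PointIdeal

variable {K : Type*} [Field K] {n : ℕ}

theorem aeval_smul_of_isHomogeneous {σ A : Type*} [Fintype σ] [CommRing A] [Algebra K A]
    {F : MvPolynomial σ K} {d : ℕ} (hF : F.IsHomogeneous d) (v : σ → K) (t : A) :
    aeval (fun k => v k • t) F = eval v F • t ^ d := by
  rw [aeval_def, eval₂_eq', eval_eq', Finset.sum_smul]
  refine Finset.sum_congr rfl fun m hm => ?_
  have hd : ∑ k, m k = d := by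
    have := hF.degree_eq_sum_deg_support hm
    rw [this, ← Finsupp.degree_apply, Finsupp.degree_eq_sum]
  simp only [Algebra.smul_def, mul_pow, Finset.prod_mul_distrib, map_mul, map_prod,
    map_pow]
  rw [Finset.prod_pow_eq_pow_sum, hd, mul_assoc]

theorem linear_mem_pointIdeal (P : ℙ K (Fin (n + 1) → K)) {F : MvPolynomial (Fin (n + 1)) K}
    (hF : F.IsHomogeneous 1) (h : eval P.rep F = 0) : F ∈ pointIdeal P :=
  Ideal.subset_span ⟨⟨1, hF⟩, h⟩

theorem minor_mem_pointIdeal (P : ℙ K (Fin (n + 1) → K)) (a b : Fin (n + 1)) :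
    C (P.rep a) * X b - C (P.rep b) * X a ∈ pointIdeal P := by
  refine linear_mem_pointIdeal P
    ((isHomogeneous_C_mul_X _ _).sub (isHomogeneous_C_mul_X _ _)) ?_
  simp [mul_comm]

/-- Modulo these linear forms every `X k` is `P.rep k` times one element `t`, so a form `F` of
degree `d` becomes `F(P) t^d`. -/
theorem pointIdeal_eq_span (P : ℙ K (Fin (n + 1) → K)) {i : Fin (n + 1)} (hi : P.rep i ≠ 0) :
    pointIdeal P = Ideal.span (Set.range fun k : Fin (n + 1) =>
      X k - C (P.rep k * (P.rep i)⁻¹) * X i) := by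
  refine le_antisymm (Ideal.span_le.2 ?_) (Ideal.span_le.2 ?_)
  · rintro F ⟨⟨d, hd⟩, hF⟩
    set L := Ideal.span (Set.range fun k : Fin (n + 1) =>
      (X k - C (P.rep k * (P.rep i)⁻¹) * X i : MvPolynomial (Fin (n + 1)) K)) with hL
    have hX : (Ideal.Quotient.mkₐ K L) = aeval fun k =>
        P.rep k • Ideal.Quotient.mkₐ K L (C (P.rep i)⁻¹ * X i) := by
      refine algHom_ext fun k => ?_
      rw [aeval_X, ← map_smul, Ideal.Quotient.mkₐ_eq_mk, Ideal.Quotient.eq]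
      refine Ideal.subset_span ⟨k, ?_⟩
      simp [smul_eq_C_mul, mul_assoc]
    have : Ideal.Quotient.mkₐ K L F = 0 := by
      rw [hX, aeval_smul_of_isHomogeneous hd, hF, zero_smul]
    exact Ideal.Quotient.eq_zero_iff_mem.1 this
  · rintro _ ⟨k, rfl⟩
    refine linear_mem_pointIdeal P ((isHomogeneous_X _ _).sub (isHomogeneous_C_mul_X _ _)) ?_
    simp [hi]

theorem exists_rep_ne_zero (P : ℙ K (Fin (n + 1) → K)) : ∃ i, P.rep i ≠ 0 :=
  Function.ne_iff.1 P.rep_nonzero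

/-- Over a field of characteristic zero the partial derivatives of `I_P ^ (m + 1)` generate
`I_P ^ m`. -/
theorem pointIdeal_pow_le_partialIdeal [CharZero K] (hn : 1 ≤ n) (P : ℙ K (Fin (n + 1) → K))
    (m : ℕ) : pointIdeal P ^ m ≤ partialIdeal (pointIdeal P ^ (m + 1)) := by
  obtain ⟨i, hi⟩ := exists_rep_ne_zero P
  set c : Fin (n + 1) → K := fun k => P.rep k * (P.rep i)⁻¹ with hc
  have hci : c i = 1 := mul_inv_cancel₀ hi
  set l : Fin (n + 1) → MvPolynomial (Fin (n + 1)) K := fun k => X k - C (c k) * X i with hl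
  have hspan : pointIdeal P = Ideal.span (Set.range l) := pointIdeal_eq_span P hi
  -- The Euler field transverse to `P`: it acts as `m` on `I_P^m / I_P^(m+1)` and has divergence
  -- `n`, since `l i = 0`.
  set E : Derivation K (MvPolynomial (Fin (n + 1)) K) (MvPolynomial (Fin (n + 1)) K) :=
    ∑ k, l k • pderiv k with hEdef
  have hEapply : ∀ F, E F = ∑ k, l k * pderiv k F := by
    intro F
    rw [hEdef, ← Derivation.coeFnAddMonoidHom_apply, map_sum, Finset.sum_apply]
    rfl
  have hEX : ∀ k, E (X k) = l k := by
    intro k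
    rw [hEapply, Finset.sum_eq_single k]
    · simp
    · intro b _ hb
      rw [pderiv_X_of_ne hb.symm, mul_zero]
    · simp
  have hEl : ∀ k, E (l k) = l k := by
    intro k
    have hli : l i = 0 := by simp [hl, hci]
    conv_lhs => rw [hl]
    simp only [map_sub, E.leibniz, hEX, derivation_C, hli]
    simp
  have hE : ∀ F, E F ∈ Ideal.span (Set.range l) := by
    intro F
    rw [hEapply]
    exact sum_mem fun k _ => Ideal.mul_mem_right _ _ (Ideal.subset_span ⟨k, rfl⟩)
  have htrace : ∑ k, pderiv k (l k) = (n : MvPolynomial (Fin (n + 1)) K) := by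
    have h1 : ∀ k, pderiv k (l k)
        = 1 - if k = i then (1 : MvPolynomial (Fin (n + 1)) K) else 0 := by
      intro k
      simp only [hl, map_sub, pderiv_X_self, pderiv_C_mul]
      split_ifs with hk
      · subst hk
        simp [hci]
      · rw [pderiv_X_of_ne (Ne.symm hk)]
        simp
    simp [h1]
  intro F hF
  have hmem : ∑ k, pderiv k (l k * F) ∈ partialIdeal (pointIdeal P ^ (m + 1)) := by
    refine sum_mem fun k _ => pderiv_mem_partialIdeal ?_ k
    rw [pow_succ', hspan]
    rw [hspan] at hF
    exact Ideal.mul_mem_mul (Ideal.subset_span ⟨k, rfl⟩) hF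
  have hsum : ∑ k, pderiv k (l k * F) = E F + n * F := by
    rw [hEapply, ← htrace, Finset.sum_mul, ← Finset.sum_add_distrib]
    refine Finset.sum_congr rfl fun k _ => ?_
    rw [Derivation.leibniz, smul_eq_mul, smul_eq_mul, mul_comm F]
  have hres : E F - m * F ∈ partialIdeal (pointIdeal P ^ (m + 1)) := by
    refine le_partialIdeal _ ?_
    rw [hspan] at hF ⊢
    exact derivation_sub_natCast_mul_mem_pow E l hEl hE m hF
  -- Modulo `I_P^(m+1)` the sum of derivatives is `(n + m) F`; `1 ≤ n` covers `m = 0`.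
  have hne : ((n + m : ℕ) : K) ≠ 0 := Nat.cast_ne_zero.2 (by omega)
  have hfin : F = C (((n + m : ℕ) : K)⁻¹) *
      (∑ k, pderiv k (l k * F) - (E F - (m : MvPolynomial (Fin (n + 1)) K) * F)) := by
    have h2 : ∑ k, pderiv k (l k * F) - (E F - (m : MvPolynomial (Fin (n + 1)) K) * F)
        = C ((n + m : ℕ) : K) * F := by
      rw [hsum, map_natCast]
      push_cast
      ring
    rw [h2, ← mul_assoc, ← C_mul, inv_mul_cancel₀ hne, C_1, one_mul]
  rw [hfin]
  exact Ideal.mul_mem_left _ _ (sub_mem hmem hres)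

theorem exists_minor_ne_zero {P Q : ℙ K (Fin (n + 1) → K)} (h : P ≠ Q) :
    ∃ a b, P.rep a * Q.rep b - P.rep b * Q.rep a ≠ 0 := by
  by_contra! hall
  obtain ⟨i, hi⟩ := exists_rep_ne_zero P
  refine h ?_
  rw [← P.mk_rep, ← Q.mk_rep, eq_comm, Projectivization.mk_eq_mk_iff']
  refine ⟨Q.rep i * (P.rep i)⁻¹, funext fun b => ?_⟩
  have := hall i b
  simp only [Pi.smul_apply, smul_eq_mul]
  field_simp
  linear_combination -this

/-- A nonzero minor lets Cramer's rule produce `X a` and `X b`; one of them has a nonzero coordinate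
at `P` and yields all the other variables. -/
theorem maxIdeal_le_sup_pointIdeal {P Q : ℙ K (Fin (n + 1) → K)} (h : P ≠ Q) :
    maxIdeal K n ≤ pointIdeal P ⊔ pointIdeal Q := by
  obtain ⟨a, b, hab⟩ := exists_minor_ne_zero h
  set J := pointIdeal P ⊔ pointIdeal Q with hJ
  have hP : ∀ a b, C (P.rep a) * X b - C (P.rep b) * X a ∈ J := fun a b =>
    le_sup_left (a := pointIdeal P) (minor_mem_pointIdeal P a b)
  have hQ : ∀ a b, C (Q.rep a) * X b - C (Q.rep b) * X a ∈ J := fun a b =>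
    le_sup_right (a := pointIdeal P) (minor_mem_pointIdeal Q a b)
  have cancel : ∀ {c : K} {F : MvPolynomial (Fin (n + 1)) K}, c ≠ 0 → C c * F ∈ J → F ∈ J := by
    intro c F hc hF
    have e : F = C c⁻¹ * (C c * F) := by
      rw [← mul_assoc, ← C_mul, inv_mul_cancel₀ hc, C_1, one_mul]
    rw [e]
    exact Ideal.mul_mem_left _ _ hF
  have solve : ∀ a b, P.rep a * Q.rep b - P.rep b * Q.rep a ≠ 0 →
      (X a : MvPolynomial (Fin (n + 1)) K) ∈ J := by
    intro a b hab
    refine cancel hab ?_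
    have e : C (P.rep a * Q.rep b - P.rep b * Q.rep a) * X a
        = C (Q.rep a) * (C (P.rep a) * X b - C (P.rep b) * X a)
          - C (P.rep a) * (C (Q.rep a) * X b - C (Q.rep b) * X a) := by
      simp only [C_sub, C_mul]; ring
    rw [e]
    exact sub_mem (Ideal.mul_mem_left _ _ (hP a b)) (Ideal.mul_mem_left _ _ (hQ a b))
  have ha : X a ∈ J := solve a b hab
  have hb : X b ∈ J := solve b a fun h0 => hab (by linear_combination -h0)
  have spread : ∀ a, P.rep a ≠ 0 → X a ∈ J → ∀ k, X k ∈ J := by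
    intro a hPa ha k
    refine cancel hPa ?_
    have := add_mem (hP a k) (Ideal.mul_mem_left _ (C (P.rep k)) ha)
    rwa [sub_add_cancel] at this
  refine Ideal.span_le.2 ?_
  rintro _ ⟨k, rfl⟩
  by_cases hPa : P.rep a = 0
  · refine spread b (fun hPb => hab ?_) hb k
    rw [hPa, hPb, zero_mul, zero_mul, sub_zero]
  · exact spread a hPa ha k

end PointIdeal

/-! ### From single points to the whole scheme -/

section FatPointSchemes

variable {K : Type*} [Field K] {n s : ℕ}

theorem maxIdeal_fg : (maxIdeal K n).FG :=
  idealOfVars_fg (Fin (n + 1)) K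

theorem equiIdeal_le_pow (P : Fin s → ℙ K (Fin (n + 1) → K)) (m : ℕ) (j : Fin s) :
    equiIdeal P m ≤ pointIdeal (P j) ^ m :=
  iInf_le _ j

theorem vanIdeal_pow_le_equiIdeal (P : Fin s → ℙ K (Fin (n + 1) → K)) (m : ℕ) :
    vanIdeal P ^ m ≤ equiIdeal P m :=
  le_iInf fun j => Ideal.pow_right_mono (iInf_le _ j) m

theorem equiIdeal_zero (P : Fin s → ℙ K (Fin (n + 1) → K)) : equiIdeal P 0 = ⊤ := by
  simp [equiIdeal, fatPointIdeal]

theorem partialIdeal_equiIdeal_le (P : Fin s → ℙ K (Fin (n + 1) → K)) (m : ℕ) :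
    partialIdeal (equiIdeal P (m + 1)) ≤ equiIdeal P m :=
  le_iInf fun j =>
    (partialIdeal_mono (equiIdeal_le_pow P (m + 1) j)).trans (partialIdeal_pow_le _ m)

/-- To multiply `I_{m𝕏}` into `J` by a power of `𝔐` it suffices to do so at each point. -/
theorem exists_maxIdeal_pow_mul_equiIdeal_le {P : Fin s → ℙ K (Fin (n + 1) → K)}
    (hP : Function.Injective P) {m N : ℕ} {J : Ideal (MvPolynomial (Fin (n + 1)) K)}
    (hvan : vanIdeal P ^ N ≤ J)
    (h : ∀ j, (∏ k ∈ Finset.univ.erase j, pointIdeal (P k)) ^ N * pointIdeal (P j) ^ m ≤ J) :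
    ∃ r : ℕ, maxIdeal K n ^ r * equiIdeal P m ≤ J := by
  rcases isEmpty_or_nonempty (Fin s) with hs | hs
  · have : vanIdeal P = ⊤ := iInf_of_empty _
    rw [this, Ideal.top_pow, top_le_iff] at hvan
    exact ⟨0, hvan ▸ le_top⟩
  obtain ⟨r, hr⟩ := exists_pow_le_iSup_prod_erase_pow maxIdeal_fg (fun j => pointIdeal (P j))
    (fun j k hjk => maxIdeal_le_sup_pointIdeal (hP.ne hjk)) N
  refine ⟨r, (Ideal.mul_mono_left hr).trans ?_⟩
  rw [Ideal.iSup_mul]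
  exact iSup_le fun j => (Ideal.mul_mono_right (equiIdeal_le_pow P m j)).trans (h j)

theorem exists_maxIdeal_pow_mul_equiIdeal_le_vanIdeal_pow {P : Fin s → ℙ K (Fin (n + 1) → K)}
    (hP : Function.Injective P) (m : ℕ) :
    ∃ r : ℕ, maxIdeal K n ^ r * equiIdeal P m ≤ vanIdeal P ^ m := by
  refine exists_maxIdeal_pow_mul_equiIdeal_le hP (N := m) le_rfl fun j => ?_
  rw [← mul_pow]
  exact Ideal.pow_right_mono (prod_erase_mul_le_iInf _ j) m

theorem exists_maxIdeal_pow_mul_equiIdeal_le_partialIdeal [CharZero K] (hn : 1 ≤ n)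
    {P : Fin s → ℙ K (Fin (n + 1) → K)} (hP : Function.Injective P) (m : ℕ) :
    ∃ r : ℕ, maxIdeal K n ^ r * equiIdeal P m ≤ partialIdeal (vanIdeal P ^ (m + 1)) := by
  refine exists_maxIdeal_pow_mul_equiIdeal_le hP (N := m + 2)
    ((Ideal.pow_le_pow_right (by omega)).trans (le_partialIdeal _)) fun j => ?_
  exact (Ideal.mul_mono_right (pointIdeal_pow_le_partialIdeal hn (P j) m)).trans
    (pow_mul_partialIdeal_pow_le (prod_erase_mul_le_iInf _ j) m)

end FatPointSchemes

end FatPoints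

open FatPoints in
theorem corollary3p2 {K : Type*} [Field K] [CharZero K] {n : ℕ} (hn : 1 ≤ n) {s : ℕ}
    (P : Fin s → ℙ K (Fin (n + 1) → K)) (hP : Function.Injective P) (ν : ℕ) (hν : 1 ≤ ν) :
    ∃ i₀ : ℕ, ∀ i : ℕ, i₀ ≤ i →
      degPart (partialIdeal (vanIdeal P)) i = degPart (maxIdeal K n) i ∧
      degPart (partialIdeal (vanIdeal P ^ (ν + 1))) i
        = degPart (partialIdeal (equiIdeal P (ν + 1))) i ∧
      degPart (partialIdeal (equiIdeal P (ν + 1))) i = degPart (equiIdeal P ν) i ∧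
      degPart (equiIdeal P ν) i = degPart (vanIdeal P ^ ν) i := by
  have hmono := partialIdeal_mono (vanIdeal_pow_le_equiIdeal P (ν + 1))
  have hle := partialIdeal_equiIdeal_le P ν
  have hpow := exists_maxIdeal_pow_mul_equiIdeal_le_partialIdeal hn hP ν
  obtain ⟨a, ha⟩ := exists_degPart_eq_of_pow_mul_le le_top
    (equiIdeal_zero P ▸ exists_maxIdeal_pow_mul_equiIdeal_le_partialIdeal hn hP 0)
  obtain ⟨b, hb⟩ := exists_degPart_eq_of_pow_mul_le (hmono.trans hle) hpow
  obtain ⟨c, hc⟩ := exists_degPart_eq_of_pow_mul_le hle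
    (hpow.imp fun _ hr => hr.trans hmono)
  obtain ⟨d, hd⟩ := exists_degPart_eq_of_pow_mul_le (vanIdeal_pow_le_equiIdeal P ν)
    (exists_maxIdeal_pow_mul_equiIdeal_le_vanIdeal_pow hP ν)
  -- The `1` is needed because `𝔐` and `S` differ in degree `0`.
  refine ⟨1 + a + b + c + d, fun i hi => ⟨?_, ?_, hc i (by omega), (hd i (by omega)).symm⟩⟩
  · rw [degPart_maxIdeal (by omega), ← ha i (by omega), zero_add, pow_one]
  · rw [hb i (by omega), hc i (by omega)]
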